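/- Let $\mathbb{K}$ be a field and let $G$ be a finite simple graph with vertex set $V(G)=\{x_1,\dots,x_n\}$. For $r\ge 1$ let $$I_r(G)=\Big(\prod_{x\in T}x \ \Big|\ T\subseteq V(G),\ |T|=r+1,\ G[T]\text{ is connected}\Big)\subseteq R=\mathbb{K}[x_1,\dots,x_n].$$ Call $G$ partially split if there are a partition $V(G)=K\sqcup S$ and a nonempty subset $K'\subseteq K$ such that $K$ is a clique of $G$, $S$ is an independent set of $G$, and the edges of $G$ between $K$ and $S$ are exactly the pairs $\{x,y\}$ with $x\in K'$ and $y\in S$. A homogeneous ideal $I\subseteq R$ generated in a single degree $d$ has a linear resolution if the graded Betti numbers of its minimal graded free resolution satisfy $\beta_{i,j}(I)=0$ whenever $j\neq i+d$ (in particular, the zero ideal has a linear resolution). **Theorem.** Let $G$ be a partially split graph. Then for all integers $r\ge 2$ and $q\ge 1$, the ideal $I_r(G)^q$ has a linear resolution. -/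

import Mathlib

/-- The connected ideal `I_r(G)` in the polynomial ring `k[x_v : v ∈ V]`: it is generated by the
squarefree monomials `∏_{x ∈ T} x`, where `T` ranges over the vertex sets with `|T| = r + 1`
whose induced subgraph `G[T]` is connected. -/
noncomputable def connectedIdeal (k : Type*) [Field k] {V : Type*} (G : SimpleGraph V) (r : ℕ) :
    Ideal (MvPolynomial V k) :=
  Ideal.span {f | ∃ T : Finset V, T.card = r + 1 ∧ (G.induce (T : Set V)).Connected ∧
    f = ∏ x ∈ T, MvPolynomial.X x}

/-- `G` is a partially split graph: `V(G) = K ⊔ S` with `K` a clique and `S` an independent set,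
and for some nonempty `K' ⊆ K` the edges between `K` and `S` are exactly the pairs `{x, y}` with
`x ∈ K'` and `y ∈ S`. -/
def IsPartiallySplit {V : Type*} (G : SimpleGraph V) : Prop :=
  ∃ K S K' : Set V, K ∪ S = Set.univ ∧ Disjoint K S ∧ G.IsClique K ∧ G.IsIndepSet S ∧
    K'.Nonempty ∧ K' ⊆ K ∧ ∀ x ∈ K, ∀ y ∈ S, G.Adj x y ↔ x ∈ K'

/-- `f` can be the entry of a degree-preserving map in a place of the matrix that corresponds to
the summand `R(-b)` of the source and the summand `R(-a)` of the target: `f` is zero or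
homogeneous of degree `b - a ≥ 0`. -/
def IsGradedEntry {k σ : Type*} [Field k] (f : MvPolynomial σ k) (a b : ℕ) : Prop :=
  f = 0 ∨ ∃ e : ℕ, a + e = b ∧ f.IsHomogeneous e

/-- A minimal graded free resolution
`0 → F_p → ⋯ → F_1 → F_0 → I → 0` of an ideal `I` of the standard graded polynomial ring
`R = k[x_s : s ∈ σ]`.  The free module `F_i = ⨁_{b ∈ ι i} R(-shift i b)` is `ι i →₀ R`, with the
basis element of `b ∈ ι i` placed in degree `shift i b`. -/
structure MinimalGradedFreeResolution {k σ : Type*} [Field k] (I : Ideal (MvPolynomial σ k)) where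
  /-- the index set of a homogeneous basis of `F_i` -/
  ι : ℕ → Type
  /-- each `F_i` has finite rank -/
  finite : ∀ i, Finite (ι i)
  /-- the resolution has finite length -/
  bounded : ∃ p, ∀ i, p < i → IsEmpty (ι i)
  /-- the degree of a basis element of `F_i` -/
  shift : ∀ i, ι i → ℕ
  /-- the map `F_0 → I`, as a map into `R` with image `I` -/
  aug : (ι 0 →₀ MvPolynomial σ k) →ₗ[MvPolynomial σ k] MvPolynomial σ k
  /-- the differential `F_{i+1} → F_i` -/
  diff : ∀ i, (ι (i + 1) →₀ MvPolynomial σ k) →ₗ[MvPolynomial σ k] (ι i →₀ MvPolynomial σ k)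
  /-- `F_0 → I` preserves degrees -/
  aug_graded : ∀ b, IsGradedEntry (aug (Finsupp.single b 1)) 0 (shift 0 b)
  /-- the differentials preserve degrees -/
  diff_graded : ∀ i b c,
    IsGradedEntry (diff i (Finsupp.single b 1) c) (shift i c) (shift (i + 1) b)
  /-- `F_0 → I` is onto `I` -/
  range_aug : LinearMap.range aug = I
  /-- exactness at `F_0` -/
  exact_aug : Function.Exact (diff 0) aug
  /-- exactness at `F_{i+1}` -/
  exact_diff : ∀ i, Function.Exact (diff (i + 1)) (diff i)
  /-- minimality: all entries of the differentials lie in the ideal generated by the variables -/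
  minimal : ∀ i b c, diff i (Finsupp.single b 1) c ∈
    Ideal.span (Set.range (MvPolynomial.X : σ → MvPolynomial σ k))

/-- The graded Betti number `β_{i,j}`: the number of summands `R(-j)` of `F_i`. -/
noncomputable def MinimalGradedFreeResolution.betti {k σ : Type*} [Field k]
    {I : Ideal (MvPolynomial σ k)} (F : MinimalGradedFreeResolution I) (i j : ℕ) : ℕ :=
  Nat.card {b : F.ι i // F.shift i b = j}

/-- `I` has a linear resolution: for some `d`, the ideal `I` is generated by forms of degree `d`
and has a minimal graded free resolution (which is unique up to isomorphism) with
`β_{i,j}(I) = 0` whenever `j ≠ i + d`. -/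
def HasLinearResolution {k σ : Type*} [Field k] (I : Ideal (MvPolynomial σ k)) : Prop :=
  ∃ d : ℕ, (∃ B : Set (MvPolynomial σ k), (∀ f ∈ B, f.IsHomogeneous d) ∧ I = Ideal.span B) ∧
    ∃ F : MinimalGradedFreeResolution I, ∀ i j, j ≠ i + d → F.betti i j = 0

/-! Write P = K', C = K and d = r + 1. A vertex of P is adjacent to every other vertex, while a
vertex of S has neighbours only in P. Hence a d-set is connected exactly when it meets P or lies in
C, and the exponent vectors of the generators of the q-th power are the sums of q indicator vectors
of such sets.

These generators have linear quotients in decreasing order of (min(deg_P, q), lex), see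
`exists_linear_quotient`. Moving vertices between factors, as in `exists_balanced`, makes every
factor meet P if deg_P ≥ q, and leaves at most one vertex of P in each factor if deg_P < q. After
that each factor ranges over a family with matroid basis exchange. `HasExchange.exists_sum_exchange`
carries exchange over to sums of bases, and exchange at the first differing coordinate moves up in
lex order.

Linear quotients give a linear resolution by iterated mapping cones: each colon ideal is generated
by variables, so its syzygies are linear, and `HasLinearSyzygies.horseshoe` glues the syzygies
together. -/

/-! ### Modules with linear syzygies, the horseshoe lemma and mapping cones. -/

section LinearSyzygies

variable {k σ : Type*} [Field k]

local notation "𝓟" => MvPolynomial σ k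

/-- `N ⊆ R^ι` has a free resolution of length less than `n` all of whose maps, including the map
from the free cover of `N` to `R^ι`, have linear forms as entries. -/
def HasLinearSyzygies : ℕ → (ι : Type) → Submodule (MvPolynomial σ k) (ι →₀ MvPolynomial σ k) → Prop
  | 0, _, N => N = ⊥
  | n + 1, ι, N => ∃ (κ : Type) (_ : Finite κ) (g : κ → ι →₀ MvPolynomial σ k),
      (∀ b c, (g b c).IsHomogeneous 1) ∧
      LinearMap.range (Finsupp.linearCombination (MvPolynomial σ k) g) = N ∧
      HasLinearSyzygies n κ (LinearMap.ker (Finsupp.linearCombination (MvPolynomial σ k) g))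

theorem hasLinearSyzygies_bot (n : ℕ) (ι : Type) :
    HasLinearSyzygies n ι (⊥ : Submodule 𝓟 (ι →₀ 𝓟)) := by
  induction n generalizing ι with
  | zero => rfl
  | succ n ih =>
    refine ⟨PEmpty, inferInstance, fun b => b.elim, fun b => b.elim, ?_, ?_⟩
    · rw [Finsupp.range_linearCombination, Set.range_eq_empty, Submodule.span_empty]
    · have h : ∀ N : Submodule 𝓟 (PEmpty →₀ 𝓟), HasLinearSyzygies n PEmpty N := fun N =>
        Subsingleton.elim ⊥ N ▸ ih _
      exact h _

theorem HasLinearSyzygies.succ {n : ℕ} {ι : Type} {N : Submodule 𝓟 (ι →₀ 𝓟)}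
    (h : HasLinearSyzygies n ι N) : HasLinearSyzygies (n + 1) ι N := by
  induction n generalizing ι with
  | zero =>
    obtain rfl : N = ⊥ := h
    exact hasLinearSyzygies_bot _ _
  | succ n ih =>
    obtain ⟨κ, hκ, g, hg, hr, h⟩ := h
    exact ⟨κ, hκ, g, hg, hr, ih h⟩

theorem HasLinearSyzygies.mono {m n : ℕ} (hmn : m ≤ n) {ι : Type} {N : Submodule 𝓟 (ι →₀ 𝓟)}
    (h : HasLinearSyzygies m ι N) : HasLinearSyzygies n ι N := by
  induction hmn with
  | refl => exact h
  | step _ ih => exact ih.succ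

theorem Finsupp.linearCombination_sumElim {S M κ κ' : Type*} [Semiring S] [AddCommMonoid M]
    [Module S M] (g : κ → M) (g' : κ' → M) (s : κ →₀ S) (t : κ' →₀ S) :
    Finsupp.linearCombination S (Sum.elim g g') (s.sumElim t) =
      Finsupp.linearCombination S g s + Finsupp.linearCombination S g' t := by
  simp only [Finsupp.linearCombination_apply]
  rw [Finsupp.sum, Finsupp.sumElim_support, Finset.sum_disjSum]
  rfl

theorem Finsupp.exists_eq_sumElim {M κ κ' : Type*} [Zero M] (z : κ ⊕ κ' →₀ M) :
    ∃ a b, z = Finsupp.sumElim a b :=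
  ⟨_, _, (Finsupp.comapDomain_sumElim_comapDomain z).symm⟩

theorem MvPolynomial.homogeneousComponent_mul_of_isHomogeneous {d : ℕ} {g : 𝓟}
    (hg : g.IsHomogeneous d) (e : ℕ) (f : 𝓟) :
    homogeneousComponent (e + d) (f * g) = homogeneousComponent e f * g := by
  have h : ∀ i, homogeneousComponent (e + d) (homogeneousComponent i f * g) =
      if e = i then homogeneousComponent i f * g else 0 := by
    intro i
    rw [homogeneousComponent_of_mem ((homogeneousComponent_isHomogeneous i f).mul hg)]
    simp
  conv_lhs => rw [← sum_homogeneousComponent f, Finset.sum_mul, map_sum]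
  simp only [h, Finset.sum_ite_eq, Finset.mem_range]
  split_ifs with he
  · rfl
  · rw [homogeneousComponent_eq_zero _ _ (by omega), zero_mul]

/-- The component of degree `e` of a vector of polynomials. -/
noncomputable def homogeneousPart (e : ℕ) {ι : Type} (z : ι →₀ 𝓟) : ι →₀ 𝓟 :=
  z.mapRange (MvPolynomial.homogeneousComponent e) (map_zero _)

theorem homogeneousPart_sumElim (e : ℕ) {ι κ : Type} (a : ι →₀ 𝓟) (b : κ →₀ 𝓟) :
    homogeneousPart e (a.sumElim b) = (homogeneousPart e a).sumElim (homogeneousPart e b) := by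
  ext1 (_ | _) <;> rfl

theorem homogeneousPart_eq_self {e : ℕ} {ι : Type} {z : ι →₀ 𝓟}
    (h : ∀ c, (z c).IsHomogeneous e) : homogeneousPart e z = z := by
  ext1 c
  exact MvPolynomial.homogeneousComponent_eq_self (h c)

theorem linearCombination_homogeneousPart {d : ℕ} {κ : Type} {g : κ → 𝓟}
    (hg : ∀ b, (g b).IsHomogeneous d) (e : ℕ) (z : κ →₀ 𝓟) :
    Finsupp.linearCombination 𝓟 g (homogeneousPart e z) =
      MvPolynomial.homogeneousComponent (e + d) (Finsupp.linearCombination 𝓟 g z) := by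
  rw [Finsupp.linearCombination_apply, Finsupp.linearCombination_apply, homogeneousPart,
    Finsupp.sum_mapRange_index (by simp), Finsupp.sum, Finsupp.sum, map_sum]
  refine Finset.sum_congr rfl fun b _ => ?_
  rw [smul_eq_mul, smul_eq_mul, MvPolynomial.homogeneousComponent_mul_of_isHomogeneous (hg b)]

theorem homogeneousPart_mem_ker_of_isHomogeneous {d : ℕ} {κ : Type} {g : κ → 𝓟}
    (hg : ∀ b, (g b).IsHomogeneous d) (e : ℕ) (z : κ →₀ 𝓟)
    (hz : z ∈ LinearMap.ker (Finsupp.linearCombination 𝓟 g)) :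
    homogeneousPart e z ∈ LinearMap.ker (Finsupp.linearCombination 𝓟 g) := by
  rw [LinearMap.mem_ker] at hz ⊢
  rw [linearCombination_homogeneousPart hg, hz, map_zero]

theorem Finsupp.linearCombination_apply_apply {κ ι : Type} (g : κ → ι →₀ 𝓟) (z : κ →₀ 𝓟) (c : ι) :
    Finsupp.linearCombination 𝓟 g z c = Finsupp.linearCombination 𝓟 (fun b => g b c) z := by
  simp [Finsupp.linearCombination_apply, Finsupp.sum, Finsupp.finsetSum_apply]

theorem homogeneousPart_mem_ker {d : ℕ} {κ ι : Type} {g : κ → ι →₀ 𝓟}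
    (hg : ∀ b c, (g b c).IsHomogeneous d) (e : ℕ) (z : κ →₀ 𝓟)
    (hz : z ∈ LinearMap.ker (Finsupp.linearCombination 𝓟 g)) :
    homogeneousPart e z ∈ LinearMap.ker (Finsupp.linearCombination 𝓟 g) := by
  rw [LinearMap.mem_ker] at hz ⊢
  ext1 c
  rw [Finsupp.linearCombination_apply_apply, linearCombination_homogeneousPart fun b => hg b c,
    ← Finsupp.linearCombination_apply_apply, hz, Finsupp.zero_apply, map_zero]

/-- The horseshoe lemma: an extension of modules with linear syzygies has linear syzygies. -/
theorem HasLinearSyzygies.horseshoe {n : ℕ} {ι ι' : Type} {N : Submodule 𝓟 (ι ⊕ ι' →₀ 𝓟)}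
    {N₁ : Submodule 𝓟 (ι →₀ 𝓟)} {N₂ : Submodule 𝓟 (ι' →₀ 𝓟)}
    (h₁ : HasLinearSyzygies n ι N₁) (h₂ : HasLinearSyzygies n ι' N₂)
    (hN₁ : ∀ a, Finsupp.sumElim a 0 ∈ N ↔ a ∈ N₁)
    (hN₂ : ∀ b, b ∈ N₂ ↔ ∃ a, Finsupp.sumElim a b ∈ N)
    (hN : ∀ z ∈ N, homogeneousPart 1 z ∈ N) : HasLinearSyzygies n (ι ⊕ ι') N := by
  induction n generalizing ι ι' with
  | zero =>
    obtain rfl : N₁ = ⊥ := h₁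
    obtain rfl : N₂ = ⊥ := h₂
    refine (Submodule.eq_bot_iff _).2 fun z hz => ?_
    obtain ⟨a, b, rfl⟩ := Finsupp.exists_eq_sumElim z
    obtain rfl : b = 0 := (Submodule.mem_bot 𝓟).1 ((hN₂ b).2 ⟨a, hz⟩)
    obtain rfl : a = 0 := (Submodule.mem_bot 𝓟).1 ((hN₁ a).1 hz)
    exact Finsupp.sumElim_zero_zero
  | succ n ih =>
    obtain ⟨κ₁, hκ₁, g₁, hg₁, hr₁, h₁⟩ := h₁
    obtain ⟨κ₂, hκ₂, g₂, hg₂, hr₂, h₂⟩ := h₂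
    have hlift : ∀ c, ∃ a : ι →₀ 𝓟, (∀ i, (a i).IsHomogeneous 1) ∧ a.sumElim (g₂ c) ∈ N := by
      intro c
      obtain ⟨a, ha⟩ := (hN₂ (g₂ c)).1 (hr₂ ▸ ⟨Finsupp.single c 1, by simp⟩)
      -- An arbitrary lift need not be linear. Its degree 1 part is, stays in `N`, and still lifts
      -- `g₂ c`, which is already linear.
      refine ⟨homogeneousPart 1 a,
        fun i => MvPolynomial.homogeneousComponent_isHomogeneous 1 (a i), ?_⟩
      have := hN _ ha
      rwa [homogeneousPart_sumElim, homogeneousPart_eq_self (hg₂ c)] at this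
    choose a ha haN using hlift
    set g : κ₁ ⊕ κ₂ → ι ⊕ ι' →₀ 𝓟 :=
      Sum.elim (fun b => (g₁ b).sumElim 0) (fun c => (a c).sumElim (g₂ c)) with hgdef
    have hg : ∀ b c, (g b c).IsHomogeneous 1 := by
      rintro (b | b) (c | c)
      · exact hg₁ b c
      · exact MvPolynomial.isHomogeneous_zero _ _ _
      · exact ha b c
      · exact hg₂ b c
    have key : ∀ s t, Finsupp.linearCombination 𝓟 g (Finsupp.sumElim s t) =
        Finsupp.sumElim (Finsupp.linearCombination 𝓟 g₁ s + Finsupp.linearCombination 𝓟 a t)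
          (Finsupp.linearCombination 𝓟 g₂ t) := by
      intro s t
      rw [hgdef, Finsupp.linearCombination_sumElim]
      ext1 (c | c) <;>
      simp only [Finsupp.add_apply, Finsupp.sumElim_inl, Finsupp.sumElim_inr,
        Finsupp.linearCombination_apply_apply]
      simp [Finsupp.linearCombination_apply]
    have hgN : ∀ z, Finsupp.linearCombination 𝓟 g z ∈ N := by
      intro z
      rw [Finsupp.linearCombination_apply]
      refine N.sum_mem fun b _ => N.smul_mem _ ?_
      rcases b with b | b
      · exact (hN₁ _).2 (hr₁ ▸ ⟨Finsupp.single b 1, by simp⟩)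
      · exact haN b
    refine ⟨κ₁ ⊕ κ₂, inferInstance, g, hg, le_antisymm ?_ ?_,
      ih h₁ h₂ ?_ ?_ fun z hz => homogeneousPart_mem_ker hg 1 z hz⟩
    · rintro _ ⟨z, rfl⟩
      exact hgN z
    · intro z hz
      obtain ⟨x, y, rfl⟩ := Finsupp.exists_eq_sumElim z
      have hy : y ∈ N₂ := (hN₂ y).2 ⟨x, hz⟩
      rw [← hr₂] at hy
      obtain ⟨t, rfl⟩ := hy
      have h0 := N.sub_mem hz (hgN (Finsupp.sumElim 0 t))
      have h1 : Finsupp.sumElim x (Finsupp.linearCombination 𝓟 g₂ t) -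
          Finsupp.linearCombination 𝓟 g (Finsupp.sumElim 0 t) =
            Finsupp.sumElim (x - Finsupp.linearCombination 𝓟 a t) 0 := by
        rw [key]
        ext1 (c | c) <;> simp
      rw [h1, hN₁, ← hr₁] at h0
      obtain ⟨s, hs⟩ := h0
      refine ⟨Finsupp.sumElim s t, ?_⟩
      rw [key, hs, sub_add_cancel]
    · intro s
      rw [LinearMap.mem_ker, LinearMap.mem_ker, key, map_zero, map_zero, add_zero]
      constructor
      · intro h
        ext1 c
        exact DFunLike.congr_fun h (Sum.inl c)
      · intro h
        rw [h, Finsupp.sumElim_zero_zero]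
    · intro t
      simp only [LinearMap.mem_ker, key]
      constructor
      · intro h
        -- A relation `t` among the `g₂` lifts to an element of `N₁`, which the `g₁` can cancel.
        have h0 : Finsupp.sumElim (-Finsupp.linearCombination 𝓟 a t) 0 ∈ N := by
          have := N.neg_mem (hgN (Finsupp.sumElim 0 t))
          rw [key, h, map_zero, zero_add] at this
          convert this using 1
          ext1 (c | c) <;> simp
        rw [hN₁, ← hr₁] at h0
        obtain ⟨s, hs⟩ := h0
        exact ⟨s, by rw [hs, neg_add_cancel, h, Finsupp.sumElim_zero_zero]⟩
      · rintro ⟨s, hs⟩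
        ext1 c
        exact DFunLike.congr_fun hs (Sum.inr c)

/-- The ideal `I` is generated by finitely many forms of degree `d` whose module of relations has
linear syzygies. -/
def HasLinearPresentation (d : ℕ) (I : Ideal 𝓟) : Prop :=
  ∃ (n : ℕ) (κ : Type) (_ : Finite κ) (g : κ → 𝓟), (∀ b, (g b).IsHomogeneous d) ∧
    LinearMap.range (Finsupp.linearCombination 𝓟 g) = I ∧
    HasLinearSyzygies n κ (LinearMap.ker (Finsupp.linearCombination 𝓟 g))

theorem hasLinearPresentation_bot (d : ℕ) : HasLinearPresentation d (⊥ : Ideal 𝓟) := by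
  refine ⟨0, PEmpty, inferInstance, fun b => b.elim, fun b => b.elim, ?_, ?_⟩
  · rw [Finsupp.range_linearCombination, Set.range_eq_empty, Submodule.span_empty]
  · exact (Submodule.eq_bot_iff _).2 fun x _ => Subsingleton.elim x 0

/-- Generators of degree 1 are themselves linear entries, so the presentation counts as one more
step, now over the free module of rank one. This is the form in which a colon ideal enters the
horseshoe. -/
theorem HasLinearPresentation.hasLinearSyzygies {J : Ideal 𝓟} (h : HasLinearPresentation 1 J) :
    ∃ n, HasLinearSyzygies n Unit (Submodule.comap (Finsupp.lapply ()) J) := by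
  obtain ⟨n, κ, hκ, g, hg, rfl, h⟩ := h
  have key : ∀ z, Finsupp.linearCombination 𝓟 (fun b => Finsupp.single () (g b)) z =
      Finsupp.single () (Finsupp.linearCombination 𝓟 g z) := by
    intro z
    ext1
    rw [Finsupp.linearCombination_apply_apply]
    simp
  refine ⟨n + 1, κ, hκ, fun b => Finsupp.single () (g b), fun b c => by simpa using hg b, ?_, ?_⟩
  · ext z
    simp only [LinearMap.mem_range, key, Submodule.mem_comap, Finsupp.lapply_apply]
    refine exists_congr fun y => ?_
    rw [Finsupp.unique_ext_iff]
    simp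
  · convert h using 1
    ext z
    simp [key]

/-- The mapping cone of a colon ideal with linear resolution. -/
theorem HasLinearPresentation.sup_span_singleton {d : ℕ} {I J : Ideal 𝓟} {u : 𝓟}
    (hI : HasLinearPresentation d I) (hu : u.IsHomogeneous d) (hJ : HasLinearPresentation 1 J)
    (hcolon : ∀ f, f ∈ J ↔ f * u ∈ I) : HasLinearPresentation d (I ⊔ Ideal.span {u}) := by
  obtain ⟨m, hm⟩ := hJ.hasLinearSyzygies
  obtain ⟨n, κ, hκ, g, hg, rfl, h⟩ := hI
  have hg' : ∀ b, (Sum.elim g (fun _ : Unit => u) b).IsHomogeneous d := by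
    rintro (b | b)
    · exact hg b
    · exact hu
  have key : ∀ s t, Finsupp.linearCombination 𝓟 (Sum.elim g fun _ : Unit => u)
      (Finsupp.sumElim s t) = Finsupp.linearCombination 𝓟 g s + t () * u := by
    intro s t
    rw [Finsupp.linearCombination_sumElim, Finsupp.linearCombination_apply 𝓟 t, Finsupp.sum,
      Finset.sum_subset (Finset.subset_univ t.support) (by simp +contextual), Finset.univ_unique,
      Finset.sum_singleton, smul_eq_mul]
  -- The relations among `g` and `u` extend the colon ideal `J` (possible coefficients of `u`) by
  -- the relations among `g`.
  refine ⟨max m n, κ ⊕ Unit, inferInstance, Sum.elim g (fun _ => u), hg', ?_,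
    (h.mono (le_max_right m n)).horseshoe (hm.mono (le_max_left m n)) ?_ ?_
      fun z hz => homogeneousPart_mem_ker_of_isHomogeneous hg' 1 z hz⟩
  · rw [Finsupp.range_linearCombination, Finsupp.range_linearCombination, Set.Sum.elim_range,
      Submodule.span_union, Set.range_const, Ideal.submodule_span_eq]
  · intro a
    simp [key]
  · intro b
    simp only [Submodule.mem_comap, Finsupp.lapply_apply, hcolon, LinearMap.mem_ker, key,
      LinearMap.mem_range]
    constructor
    · rintro ⟨y, hy⟩
      exact ⟨-y, by rw [map_neg, hy, neg_add_cancel]⟩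
    · rintro ⟨a, ha⟩
      exact ⟨-a, by rw [map_neg, neg_eq_iff_add_eq_zero, ha]⟩

end LinearSyzygies

/-! ### From linear syzygies and linear quotients to minimal resolutions. -/

section Resolution

variable {k σ : Type*} [Field k]

local notation "𝓟" => MvPolynomial σ k

/-- A stage in the construction of a resolution: a submodule of a free module with linear
syzygies. -/
structure SyzygyStage (k σ : Type*) [Field k] where
  /-- a bound for the length of a resolution -/
  len : ℕ
  /-- the index set of the basis of the free module -/
  ι : Type
  /-- the submodule of the free module -/
  N : Submodule (MvPolynomial σ k) (ι →₀ MvPolynomial σ k)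
  /-- its syzygies are linear -/
  linear : HasLinearSyzygies len ι N

/-- One step of the resolution, made total so that it can be iterated by choice: once the length is
exhausted it returns the empty basis. -/
theorem SyzygyStage.exists_next (s : SyzygyStage k σ) :
    ∃ (t : SyzygyStage k σ) (g : t.ι → s.ι →₀ 𝓟), Finite t.ι ∧ t.len = s.len - 1 ∧
      (∀ b c, (g b c).IsHomogeneous 1) ∧
      LinearMap.range (Finsupp.linearCombination 𝓟 g) = s.N ∧
      LinearMap.ker (Finsupp.linearCombination 𝓟 g) = t.N ∧ (s.len = 0 → IsEmpty t.ι) := by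
  obtain ⟨n, ι, N, h⟩ := s
  cases n with
  | zero =>
    obtain rfl : N = ⊥ := h
    refine ⟨⟨0, PEmpty, ⊥, hasLinearSyzygies_bot _ _⟩, fun b => b.elim,
      inferInstanceAs (Finite PEmpty), rfl, fun b => b.elim, ?_, Subsingleton.elim (α := Submodule 𝓟 (PEmpty →₀ 𝓟)) _ _,
      fun _ => inferInstanceAs (IsEmpty PEmpty)⟩
    rw [Finsupp.range_linearCombination, Submodule.span_eq_bot]
    rintro _ ⟨b, _⟩
    exact b.elim
  | succ n =>
    obtain ⟨κ, hκ, g, hg, hr, h⟩ := h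
    exact ⟨⟨n, κ, _, h⟩, g, hκ, rfl, hg, hr, rfl, fun h => (Nat.succ_ne_zero n h).elim⟩

theorem HasLinearPresentation.hasLinearResolution {d : ℕ} {I : Ideal 𝓟}
    (h : HasLinearPresentation d I) : HasLinearResolution I := by
  obtain ⟨n, κ, hκ, g₀, hg₀, hr₀, h⟩ := h
  refine ⟨d, ⟨Set.range g₀, ?_, ?_⟩, ?_⟩
  · rintro _ ⟨b, rfl⟩
    exact hg₀ b
  · rw [← hr₀, Finsupp.range_linearCombination, Ideal.submodule_span_eq]
  choose next g hfin hlen hg hr hker hempty using SyzygyStage.exists_next (k := k) (σ := σ)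
  let s : ℕ → SyzygyStage k σ := fun i => next^[i] ⟨n, κ, _, h⟩
  have hs : ∀ i, s (i + 1) = next (s i) := fun i => Function.iterate_succ_apply' next i _
  have hslen : ∀ i, (s i).len = n - i := by
    intro i
    induction i with
    | zero => rfl
    | succ i ih => rw [hs, hlen, ih, Nat.sub_sub]
  have hdiff : ∀ i, ∃ f : (s (i + 1)).ι → (s i).ι →₀ 𝓟, (∀ b c, (f b c).IsHomogeneous 1) ∧
      LinearMap.range (Finsupp.linearCombination 𝓟 f) = (s i).N ∧
      LinearMap.ker (Finsupp.linearCombination 𝓟 f) = (s (i + 1)).N := by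
    intro i
    rw [hs i]
    exact ⟨g (s i), hg _, hr _, hker _⟩
  choose f hf hfr hfk using hdiff
  have haug : ∀ b, (Finsupp.linearCombination 𝓟 g₀ (Finsupp.single b 1)).IsHomogeneous d := by
    intro b
    rw [Finsupp.linearCombination_single, one_smul]
    exact hg₀ b
  let F : MinimalGradedFreeResolution I :=
    { ι := fun i => (s i).ι
      finite := by
        rintro (_ | i)
        · exact hκ
        · rw [hs]
          exact hfin _
      bounded := by
        refine ⟨n, fun i hi => ?_⟩
        obtain ⟨i, rfl⟩ := Nat.exists_eq_add_one_of_ne_zero (Nat.ne_zero_of_lt hi)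
        rw [hs]
        exact hempty _ (by rw [hslen]; omega)
      shift := fun i _ => i + d
      aug := Finsupp.linearCombination 𝓟 g₀
      diff := fun i => Finsupp.linearCombination 𝓟 (f i)
      aug_graded := fun b => Or.inr ⟨d, rfl, haug b⟩
      diff_graded := fun i b c => Or.inr ⟨1, by omega, by simpa using hf i b c⟩
      range_aug := hr₀
      exact_aug := by
        rw [LinearMap.exact_iff, hfr]
        rfl
      exact_diff := by
        intro i
        rw [LinearMap.exact_iff, hfr, hfk]
      -- Minimality is automatic: a monomial of degree 1 involves a variable.
      minimal := by
        intro i b c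
        rw [Finsupp.linearCombination_single, one_smul, ← Set.image_univ,
          MvPolynomial.mem_ideal_span_X_image]
        intro m hm
        have h1 := hf i b c (MvPolynomial.mem_support_iff.1 hm)
        by_contra! h0
        obtain rfl : m = 0 := Finsupp.ext fun x => h0 x (Set.mem_univ x)
        simp at h1 }
  refine ⟨F, fun i j hij => ?_⟩
  have : IsEmpty {b : F.ι i // F.shift i b = j} := ⟨fun b => hij b.2.symm⟩
  exact Nat.card_of_isEmpty

theorem MvPolynomial.mul_X_mem_span_X_image_iff {L : Set σ} {x : σ} (hx : x ∉ L) (f : 𝓟) :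
    f * X x ∈ Ideal.span (X '' L : Set 𝓟) ↔ f ∈ Ideal.span (X '' L : Set 𝓟) := by
  classical
  refine ⟨fun h => ?_, fun h => Ideal.mul_mem_right _ _ h⟩
  rw [mem_ideal_span_X_image] at h ⊢
  intro m hm
  obtain ⟨i, hi, h0⟩ := h (m + Finsupp.single x 1) (by
    rw [support_mul_X]
    exact Finset.mem_map_of_mem (addRightEmbedding _) hm)
  refine ⟨i, hi, ?_⟩
  have hne : x ≠ i := fun hxi => hx (hxi ▸ hi)
  simpa [Finsupp.single_apply, hne] using h0

/-- A variable outside `L` is a nonzerodivisor modulo `L`, so each new variable has the previous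
ideal as its colon ideal, and the induction hypothesis serves twice. -/
theorem hasLinearPresentation_span_X_image (L : Finset σ) :
    HasLinearPresentation 1 (Ideal.span (MvPolynomial.X '' (L : Set σ) : Set 𝓟)) := by
  classical
  induction L using Finset.induction_on with
  | empty => simpa using hasLinearPresentation_bot 1
  | insert x L hx ih =>
    rw [Finset.coe_insert, Set.image_insert_eq, Set.insert_eq, Set.union_comm, Ideal.span_union]
    refine ih.sup_span_singleton (MvPolynomial.isHomogeneous_X _ x) ih fun f => ?_
    rw [MvPolynomial.mul_X_mem_span_X_image_iff (by simpa using hx)]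

/-- An ideal generated by monomials of one degree has a linear resolution if its generators have
linear quotients when listed by decreasing value of `f`. -/
theorem hasLinearResolution_of_linearQuotients [Finite σ] {α : Type*} [LinearOrder α]
    (A : Finset (σ →₀ ℕ)) (f : (σ →₀ ℕ) → α) (hf : f.Injective) (d : ℕ)
    (hd : ∀ u ∈ A, u.degree = d)
    (hA : ∀ u ∈ A, ∀ v ∈ A, f u < f v →
      ∃ w ∈ A, f u < f w ∧ ∃ x, w ≤ u + Finsupp.single x 1 ∧ u x < v x) :
    HasLinearResolution
      (Ideal.span ((fun u => MvPolynomial.monomial u (1 : k)) '' (A : Set (σ →₀ ℕ)))) := by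
  classical
  refine HasLinearPresentation.hasLinearResolution (d := d) ?_
  -- The generator `a` of smallest value is adjoined last, so `A` consists of exactly the generators
  -- listed before it.
  induction A using Finset.induction_on_min_value f with
  | empty => simpa using hasLinearPresentation_bot d
  | insert a A ha hmin ih =>
    have hlt : ∀ u ∈ A, f a < f u := fun u hu =>
      lt_of_le_of_ne (hmin u hu) fun h => ha (hf h ▸ hu)
    have hdA : ∀ u ∈ A, u.degree = d := fun u hu => hd u (Finset.mem_insert_of_mem hu)
    have ih := ih hdA fun u hu v hv huv => by
      obtain ⟨w, hw, huw, h⟩ :=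
        hA u (Finset.mem_insert_of_mem hu) v (Finset.mem_insert_of_mem hv) huv
      refine ⟨w, Finset.mem_of_mem_insert_of_ne hw ?_, huw, h⟩
      rintro rfl
      exact (hlt u hu).not_gt huw
    rw [Finset.coe_insert, Set.image_insert_eq, Set.insert_eq, Set.union_comm, Ideal.span_union]
    -- These are the variables in the colon ideal of `a`; the hypothesis on `A` says that they
    -- generate it.
    have hfin : {x : σ | ∃ w ∈ A, w ≤ a + Finsupp.single x 1}.Finite := Set.toFinite _
    have hJ := hasLinearPresentation_span_X_image (k := k) hfin.toFinset
    rw [Set.Finite.coe_toFinset] at hJ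
    refine ih.sup_span_singleton ?_ hJ fun p => ?_
    · exact MvPolynomial.isHomogeneous_monomial _ (hd a (Finset.mem_insert_self a A))
    constructor
    · intro hp
      refine Submodule.span_induction ?_ (by simp) (fun x y _ _ hx hy => ?_)
        (fun c x _ hx => ?_) hp
      · rintro _ ⟨x, ⟨w, hw, hwx⟩, rfl⟩
        rw [MvPolynomial.mem_ideal_span_monomial_image]
        intro m hm
        refine ⟨w, hw, ?_⟩
        rw [MvPolynomial.X, MvPolynomial.monomial_mul] at hm
        rw [Finset.mem_singleton.1 (MvPolynomial.support_monomial_subset hm), add_comm]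
        exact hwx
      · rw [add_mul]
        exact Ideal.add_mem _ hx hy
      · rw [smul_eq_mul, mul_assoc]
        exact Ideal.mul_mem_left _ _ hx
    · intro hp
      rw [MvPolynomial.mem_ideal_span_monomial_image] at hp
      rw [MvPolynomial.mem_ideal_span_X_image]
      intro m hm
      obtain ⟨v, hv, hvm⟩ := hp (m + a) (by
        rw [MvPolynomial.mem_support_iff, MvPolynomial.coeff_mul_monomial, mul_one]
        exact MvPolynomial.mem_support_iff.1 hm)
      obtain ⟨w, hw, haw, x, hwx, hx⟩ := hA a (Finset.mem_insert_self a A) v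
        (Finset.mem_insert_of_mem hv) (hlt v hv)
      refine ⟨x, ⟨w, Finset.mem_of_mem_insert_of_ne hw ?_, hwx⟩, ?_⟩
      · rintro rfl
        exact haw.false
      · have := hvm x
        rw [Finsupp.add_apply] at this
        omega

end Resolution

/-! ### Basis exchange for families of sets and for sums of bases. -/

section Exchange

variable {V : Type*}

/-- The exponent vector of the squarefree monomial with support `T`. -/
noncomputable def indicatorVec (T : Finset V) : V →₀ ℕ := ∑ x ∈ T, Finsupp.single x 1

theorem degree_indicatorVec (T : Finset V) : (indicatorVec T).degree = T.card := by
  simp [indicatorVec, map_sum]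

theorem sum_indicatorVec_update {ι : Type*} [Fintype ι] [DecidableEq ι] (T : ι → Finset V)
    (i : ι) (X : Finset V) :
    ∑ j, indicatorVec (Function.update T i X j) + indicatorVec (T i) =
      ∑ j, indicatorVec (T j) + indicatorVec X := by
  rw [← Finset.add_sum_erase _ _ (Finset.mem_univ i), Function.update_self,
    ← Finset.add_sum_erase _ (fun j => indicatorVec (T j)) (Finset.mem_univ i),
    Finset.sum_congr rfl fun j hj => by
      rw [Function.update_of_ne (Finset.ne_of_mem_erase hj)]]
  abel

variable [DecidableEq V]

theorem indicatorVec_apply (T : Finset V) (x : V) : indicatorVec T x = if x ∈ T then 1 else 0 := by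
  simp [indicatorVec, Finsupp.finsetSum_apply, Finsupp.single_apply]

theorem sum_indicatorVec (P T : Finset V) : ∑ x ∈ P, indicatorVec T x = (T ∩ P).card := by
  simp [indicatorVec_apply, Finset.inter_comm]

theorem indicatorVec_exchange {B : Finset V} {y z : V} (hy : y ∉ B) (hz : z ∈ B) :
    indicatorVec (insert y (B.erase z)) + Finsupp.single z 1 =
      indicatorVec B + Finsupp.single y 1 := by
  rw [indicatorVec, Finset.sum_insert (fun h => hy (Finset.mem_of_mem_erase h)), add_assoc,
    Finset.sum_erase_add _ _ hz, add_comm]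
  rfl

theorem card_exchange {B : Finset V} {y z : V} (hy : y ∉ B) (hz : z ∈ B) :
    (insert y (B.erase z)).card = B.card := by
  rw [Finset.card_insert_of_notMem (fun h => hy (Finset.mem_of_mem_erase h)),
    Finset.card_erase_add_one hz]

/-- The basis exchange property of a family of sets. -/
def HasExchange (F : Set (Finset V)) : Prop :=
  ∀ B ∈ F, ∀ C ∈ F, ∀ x ∈ C \ B, ∃ y ∈ B \ C, insert x (B.erase y) ∈ F

theorem exists_mem_sdiff_of_card_eq {B C : Finset V} {x : V} (h : B.card = C.card)
    (hx : x ∈ C \ B) : ∃ y, y ∈ B \ C := by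
  rw [← Finset.Nonempty, ← Finset.card_pos, Finset.card_sdiff_comm h, Finset.card_pos]
  exact ⟨x, hx⟩

theorem hasExchange_subset (d : ℕ) (C : Finset V) :
    HasExchange {T : Finset V | T.card = d ∧ T ⊆ C} := by
  rintro A ⟨hA, hAC⟩ B ⟨hB, hBC⟩ x hx
  obtain ⟨y, hy⟩ := exists_mem_sdiff_of_card_eq (hA.trans hB.symm) hx
  rw [Finset.mem_sdiff] at hx
  refine ⟨y, hy, (card_exchange hx.2 (Finset.mem_sdiff.1 hy).1).trans hA, ?_⟩
  exact Finset.insert_subset (hBC hx.1) ((Finset.erase_subset _ _).trans hAC)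

/-- Failure of every exchange would mean `x ∉ P` and that each `y ∈ A \ B` is the only vertex of `A`
in `P`. Then a vertex of `B ∩ P` lies outside `A` and differs from `x`, so `A \ B` has two elements,
a contradiction. -/
theorem hasExchange_inter_nonempty (d : ℕ) (P : Finset V) :
    HasExchange {T : Finset V | T.card = d ∧ (T ∩ P).Nonempty} := by
  rintro A ⟨hA, hAP⟩ B ⟨hB, hBP⟩ x hx
  suffices h : ∃ y ∈ A \ B, (insert x (A.erase y) ∩ P).Nonempty by
    obtain ⟨y, hy, h⟩ := h
    exact ⟨y, hy, (card_exchange (Finset.mem_sdiff.1 hx).2 (Finset.mem_sdiff.1 hy).1).trans hA, h⟩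
  have hcard : (A \ B).card = (B \ A).card := Finset.card_sdiff_comm (hA.trans hB.symm)
  by_contra! hno
  have hno' : ∀ y ∈ A \ B, ∀ p ∈ P, p ≠ x ∧ (p ∈ A → p = y) := by
    intro y hy p hp
    have h := Finset.eq_empty_iff_forall_notMem.1 (hno y hy) p
    simp only [Finset.mem_inter, Finset.mem_insert, Finset.mem_erase] at h
    tauto
  obtain ⟨y, hy⟩ := exists_mem_sdiff_of_card_eq (hA.trans hB.symm) hx
  obtain ⟨p, hp⟩ := hBP
  obtain ⟨a, ha⟩ := hAP
  rw [Finset.mem_inter] at hp ha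
  by_cases hpA : p ∈ A
  · have := (hno' y hy p hp.2).2 hpA
    exact (Finset.mem_sdiff.1 (this ▸ hy)).2 hp.1
  · have h2 : 1 < (A \ B).card := by
      rw [hcard, Finset.one_lt_card]
      exact ⟨p, Finset.mem_sdiff.2 ⟨hp.1, hpA⟩, x, hx, (hno' y hy p hp.2).1⟩
    obtain ⟨y', hy', z', hz', hne⟩ := Finset.one_lt_card.1 h2
    exact hne (((hno' y' hy' a ha.2).2 ha.1).symm.trans ((hno' z' hz' a ha.2).2 ha.1))

/-- The parts inside and outside `P` have fixed sizes, so `y` can be taken on the same side of `P`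
as `x`. -/
theorem hasExchange_card_inter (d e : ℕ) (P : Finset V) :
    HasExchange {T : Finset V | T.card = d ∧ (T ∩ P).card = e} := by
  rintro A ⟨hA, hAP⟩ B ⟨hB, hBP⟩ x hx
  have hx' := Finset.mem_sdiff.1 hx
  by_cases hxP : x ∈ P
  · obtain ⟨y, hy⟩ := exists_mem_sdiff_of_card_eq (hAP.trans hBP.symm)
      (x := x) (by simp [hx'.1, hx'.2, hxP])
    simp only [Finset.mem_sdiff, Finset.mem_inter, not_and] at hy
    have hyB : y ∉ B := fun h => hy.2 h hy.1.2
    refine ⟨y, Finset.mem_sdiff.2 ⟨hy.1.1, hyB⟩, (card_exchange hx'.2 hy.1.1).trans hA, ?_⟩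
    rw [Finset.insert_inter_of_mem hxP, Finset.erase_inter, card_exchange _ _, hAP]
    · simp [hx'.2]
    · exact Finset.mem_inter.2 hy.1
  · have h : (A \ P).card = (B \ P).card := by
      have h1 := Finset.card_inter_add_card_sdiff A P
      have h2 := Finset.card_inter_add_card_sdiff B P
      omega
    obtain ⟨y, hy⟩ := exists_mem_sdiff_of_card_eq h (x := x) (by simp [hx'.1, hx'.2, hxP])
    simp only [Finset.mem_sdiff, not_and, not_not] at hy
    have hyB : y ∉ B := fun h => hy.1.2 (hy.2 h)
    refine ⟨y, Finset.mem_sdiff.2 ⟨hy.1.1, hyB⟩, (card_exchange hx'.2 hy.1.1).trans hA, ?_⟩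
    rw [Finset.insert_inter_of_notMem hxP, Finset.erase_inter, Finset.erase_eq_of_notMem, hAP]
    simp [hy.1.2]

variable {ι : Type*} [Fintype ι]

theorem sum_indicatorVec_exchange [DecidableEq ι] (T : ι → Finset V) {i : ι} {y z : V}
    (hy : y ∉ T i) (hz : z ∈ T i) :
    ∑ j, indicatorVec (Function.update T i (insert y ((T i).erase z)) j) + Finsupp.single z 1 =
      ∑ j, indicatorVec (T j) + Finsupp.single y 1 := by
  have h1 := sum_indicatorVec_update T i (insert y ((T i).erase z))
  have h2 := indicatorVec_exchange hy hz
  apply add_right_cancel (b := indicatorVec (T i))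
  rw [add_right_comm, h1, add_assoc, h2]
  abel

/-- The exchange property of sums of bases: in a sum of indicator vectors of bases, a coordinate
may be increased towards another such sum at the cost of a coordinate that is too large. -/
theorem HasExchange.exists_sum_exchange {F : ι → Set (Finset V)} (hF : ∀ i, HasExchange (F i))
    {B C : ι → Finset V} (hB : ∀ i, B i ∈ F i) (hC : ∀ i, C i ∈ F i) {y : V}
    (hy : (∑ i, indicatorVec (B i)) y < (∑ i, indicatorVec (C i)) y) :
    ∃ (z : V) (B' : ι → Finset V), (∀ i, B' i ∈ F i) ∧
      ∑ i, indicatorVec (B' i) + Finsupp.single z 1 =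
        ∑ i, indicatorVec (B i) + Finsupp.single y 1 ∧
      (∑ i, indicatorVec (C i)) z < (∑ i, indicatorVec (B i)) z := by
  classical
  induction hn : ∑ i, (C i \ B i).card using Nat.strong_induction_on generalizing B y with
  | _ n ih =>
  obtain ⟨i, hi⟩ : ∃ i, y ∈ C i \ B i := by
    by_contra! hno
    refine hy.not_ge ?_
    rw [Finsupp.finsetSum_apply, Finsupp.finsetSum_apply]
    refine Finset.sum_le_sum fun i _ => ?_
    have := hno i
    rw [Finset.mem_sdiff] at this
    rw [indicatorVec_apply, indicatorVec_apply]
    split_ifs <;> simp_all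
  obtain ⟨z, hz, hBz⟩ := hF i _ (hB i) _ (hC i) y hi
  rw [Finset.mem_sdiff] at hi hz
  set B₁ := Function.update B i (insert y ((B i).erase z)) with hB₁
  have hsum := sum_indicatorVec_exchange B hi.2 hz.1
  rw [← hB₁] at hsum
  have hB₁F : ∀ j, B₁ j ∈ F j := by
    intro j
    by_cases hj : j = i
    · subst hj
      rwa [hB₁, Function.update_self]
    · rw [hB₁, Function.update_of_ne hj]
      exact hB j
  by_cases hlt : (∑ i, indicatorVec (C i)) z < (∑ i, indicatorVec (B i)) z
  · exact ⟨z, B₁, hB₁F, hsum, hlt⟩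
  have hzy : z ≠ y := fun h => hi.2 (h ▸ hz.1)
  have hval : ∀ x, (∑ i, indicatorVec (B₁ i)) x + Finsupp.single z 1 x =
      (∑ i, indicatorVec (B i)) x + Finsupp.single y 1 x := fun x => DFunLike.congr_fun hsum x
  -- If `z` was not too large, the exchange leaves it too small, so it takes over the role of `y`.
  -- The measure drops because `y ∈ C i` was gained and `z ∉ C i` was lost.
  have hB₁z : (∑ i, indicatorVec (B₁ i)) z < (∑ i, indicatorVec (C i)) z := by
    have := hval z
    rw [Finsupp.single_eq_same, Finsupp.single_eq_of_ne hzy] at this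
    omega
  have hdec : ∑ j, (C j \ B₁ j).card < n := by
    rw [← hn]
    have hi₁ : C i \ B₁ i ⊂ C i \ B i := by
      rw [hB₁, Function.update_self, Finset.ssubset_iff_of_subset]
      · exact ⟨y, by simp [hi.1, hi.2], by simp⟩
      · intro x hx
        simp only [Finset.mem_sdiff, Finset.mem_insert, Finset.mem_erase, not_or, not_and] at hx ⊢
        exact ⟨hx.1, hx.2.2 fun h => hz.2 (h ▸ hx.1)⟩
    refine Finset.sum_lt_sum (fun j _ => ?_) ⟨i, Finset.mem_univ i, Finset.card_lt_card hi₁⟩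
    by_cases hj : j = i
    · subst hj
      exact Finset.card_le_card hi₁.subset
    · rw [hB₁, Function.update_of_ne hj]
  obtain ⟨z', B', hB', hsum', hz'⟩ := ih _ hdec hB₁F hB₁z rfl
  refine ⟨z', B', hB', hsum'.trans hsum, ?_⟩
  have h1 := hval z'
  by_cases hzy' : z' = y
  · subst hzy'
    rw [Finsupp.single_eq_same, Finsupp.single_eq_of_ne hzy.symm] at h1
    omega
  · rw [Finsupp.single_eq_of_ne hzy'] at h1
    omega

end Exchange

/-! ### Exchange and the lexicographic order. -/

section Lex

variable {V : Type*} [LinearOrder V] {ι : Type*} [Fintype ι]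

/-- Exchange at the first coordinate `x` where `u` and `v` differ. The coordinate `z` that pays has
`v z < u z`, so it comes after `x`, and the result is lexicographically larger. -/
theorem HasExchange.exists_lex_exchange {F : ι → Set (Finset V)} (hF : ∀ i, HasExchange (F i))
    {B C : ι → Finset V} (hB : ∀ i, B i ∈ F i) (hC : ∀ i, C i ∈ F i) {u v : V →₀ ℕ}
    (hu : u = ∑ i, indicatorVec (B i)) (hv : v = ∑ i, indicatorVec (C i))
    (huv : toLex (u : V → ℕ) < toLex (v : V → ℕ)) :
    ∃ (x z : V) (w : V →₀ ℕ) (B' : ι → Finset V), (∀ i, B' i ∈ F i) ∧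
      w = ∑ i, indicatorVec (B' i) ∧ w + Finsupp.single z 1 = u + Finsupp.single x 1 ∧
      u x < v x ∧ v z < u z ∧ toLex (u : V → ℕ) < toLex (w : V → ℕ) := by
  obtain ⟨x, hlt, hx⟩ := huv
  have hx : u x < v x := hx
  obtain ⟨z, B', hB', hsum, hz⟩ := HasExchange.exists_sum_exchange hF hB hC (y := x)
    (by rwa [← hu, ← hv])
  rw [← hu] at hsum
  rw [← hu, ← hv] at hz
  have hval : ∀ y, (∑ i, indicatorVec (B' i)) y + Finsupp.single z 1 y =
      u y + Finsupp.single x 1 y := fun y => DFunLike.congr_fun hsum y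
  have hzx : z ≠ x := by
    rintro rfl
    exact hx.not_gt hz
  refine ⟨x, z, _, B', hB', rfl, hsum, hx, hz, x, fun y hy => ?_, ?_⟩
  · have h1 : u y = v y := hlt y hy
    have h2 := hval y
    rw [Finsupp.single_eq_of_ne hy.ne, Finsupp.single_eq_of_ne] at h2
    · exact h2.symm
    · rintro rfl
      omega
  · have h2 := hval x
    rw [Finsupp.single_eq_same, Finsupp.single_eq_of_ne hzx.symm] at h2
    change u x < (∑ i, indicatorVec (B' i)) x
    omega

end Lex

/-! ### Redistributing the vertices of P among the factors. -/

section PartiallySplit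

variable {V : Type*} [DecidableEq V]

/-- The supports of the generators: sets of size `d` that meet `P` or lie in `C`. -/
def meetOrSubset (P C : Finset V) (d : ℕ) : Set (Finset V) :=
  {T | T.card = d ∧ ((T ∩ P).Nonempty ∨ T ⊆ C)}

theorem sum_sum_indicatorVec {ι : Type*} [Fintype ι] (P : Finset V) (T : ι → Finset V) :
    ∑ x ∈ P, (∑ i, indicatorVec (T i)) x = ∑ i, (T i ∩ P).card := by
  simp only [Finsupp.finsetSum_apply]
  rw [Finset.sum_comm]
  exact Finset.sum_congr rfl fun i _ => sum_indicatorVec P (T i)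

theorem sum_exchange {P : Finset V} {u w : V →₀ ℕ} {x z : V}
    (h : w + Finsupp.single z 1 = u + Finsupp.single x 1) :
    ∑ y ∈ P, w y + (if z ∈ P then 1 else 0) = ∑ y ∈ P, u y + (if x ∈ P then 1 else 0) := by
  have := congrArg (fun f : V →₀ ℕ => ∑ y ∈ P, f y) h
  simpa [Finset.sum_add_distrib, Finsupp.single_apply] using this

variable {ι : Type*} [Fintype ι]

/-- A sum of generators can be written such that all of them meet `P` or none of them meets `P`
more than once. -/
theorem exists_balanced {P C : Finset V} {d : ℕ} (T : ι → Finset V)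
    (hT : ∀ i, T i ∈ meetOrSubset P C d) :
    ∃ T' : ι → Finset V, (∀ i, T' i ∈ meetOrSubset P C d) ∧
      ∑ i, indicatorVec (T' i) = ∑ i, indicatorVec (T i) ∧
      ((∀ i, (T' i ∩ P).Nonempty) ∨ ∀ i, (T' i ∩ P).card ≤ 1) := by
  classical
  induction hn : (Finset.univ.filter fun i => T i ∩ P = ∅).card using Nat.strong_induction_on
    generalizing T with
  | _ n ih =>
  by_cases h1 : ∀ i, (T i ∩ P).Nonempty
  · exact ⟨T, hT, rfl, Or.inl h1⟩
  by_cases h2 : ∀ i, (T i ∩ P).card ≤ 1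
  · exact ⟨T, hT, rfl, Or.inr h2⟩
  push Not at h1 h2
  obtain ⟨i, hi⟩ := h1
  obtain ⟨j, hj⟩ := h2
  obtain ⟨c, hc⟩ : (T j ∩ P).Nonempty := Finset.card_pos.1 (by omega)
  have hiP : ∀ x ∈ T i, x ∉ P := fun x hx hxP =>
    Finset.notMem_empty x (hi ▸ Finset.mem_inter.2 ⟨hx, hxP⟩)
  have hcj := Finset.mem_inter.1 hc
  have hci : c ∉ T i := fun h => hiP c h hcj.2
  -- Factor `i` misses `P` and factor `j` meets it twice. Trading `b` for `c` preserves the sum, and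
  -- afterwards both meet `P`, so fewer factors miss it.
  obtain ⟨b, hb⟩ := exists_mem_sdiff_of_card_eq ((hT i).1.trans (hT j).1.symm)
    (Finset.mem_sdiff.2 ⟨hcj.1, hci⟩)
  rw [Finset.mem_sdiff] at hb
  have hij : i ≠ j := by
    rintro rfl
    exact hb.2 hb.1
  set T₁ := Function.update T i (insert c ((T i).erase b)) with hT₁
  have hT₁j : T₁ j = T j := Function.update_of_ne hij.symm _ _
  set T₂ := Function.update T₁ j (insert b ((T₁ j).erase c)) with hT₂
  have hT₂i : T₂ i = insert c ((T i).erase b) := by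
    rw [hT₂, Function.update_of_ne hij, hT₁, Function.update_self]
  have hT₂j : T₂ j = insert b ((T j).erase c) := by
    rw [hT₂, Function.update_self, hT₁j]
  have hT₂o : ∀ l, l ≠ i → l ≠ j → T₂ l = T l := fun l hli hlj => by
    rw [hT₂, Function.update_of_ne hlj, hT₁, Function.update_of_ne hli]
  have hmi : (T₂ i ∩ P).Nonempty := ⟨c, by simp [hT₂i, hcj.2]⟩
  have hmj : (T₂ j ∩ P).Nonempty := by
    obtain ⟨x, hx, y, hy, hxy⟩ := Finset.one_lt_card.1 hj
    rw [Finset.mem_inter] at hx hy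
    by_cases hxc : x = c
    · exact ⟨y, by simp [hT₂j, hy, hxc ▸ hxy.symm]⟩
    · exact ⟨x, by simp [hT₂j, hx, hxc]⟩
  have hsum : ∑ l, indicatorVec (T₂ l) = ∑ l, indicatorVec (T l) := by
    have e1 := sum_indicatorVec_exchange T hci hb.1
    have e2 := sum_indicatorVec_exchange T₁ (i := j) (y := b) (z := c)
      (hT₁j ▸ hb.2) (hT₁j ▸ hcj.1)
    rw [← hT₁] at e1
    rw [← hT₂, e1] at e2
    exact add_right_cancel e2
  have hmem : ∀ l, T₂ l ∈ meetOrSubset P C d := by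
    intro l
    by_cases hli : l = i
    · subst hli
      exact ⟨by rw [hT₂i, card_exchange hci hb.1, (hT l).1], Or.inl hmi⟩
    by_cases hlj : l = j
    · subst hlj
      exact ⟨by rw [hT₂j, card_exchange hb.2 hcj.1, (hT l).1], Or.inl hmj⟩
    rw [hT₂o l hli hlj]
    exact hT l
  have hlt : (Finset.univ.filter fun l => T₂ l ∩ P = ∅).card < n := by
    rw [← hn]
    refine Finset.card_lt_card ((Finset.ssubset_iff_of_subset fun l hl => ?_).2 ⟨i, ?_, ?_⟩)
    · rw [Finset.mem_filter] at hl ⊢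
      refine ⟨hl.1, ?_⟩
      rw [← hT₂o l, hl.2]
      · rintro rfl
        exact hmi.ne_empty hl.2
      · rintro rfl
        exact hmj.ne_empty hl.2
    · simp [hi]
    · simp [hmi.ne_empty]
  obtain ⟨T', hT', hs, h⟩ := ih _ hlt T₂ hmem rfl
  exact ⟨T', hT', hs.trans hsum, h⟩

/-- If no factor of a balanced form meets `P` twice, a total of at least one per factor forces
exactly one in each. -/
theorem exists_all_meet_of_card_le {P C : Finset V} {d : ℕ} (T : ι → Finset V)
    (hT : ∀ i, T i ∈ meetOrSubset P C d)
    (h : Fintype.card ι ≤ ∑ x ∈ P, (∑ i, indicatorVec (T i)) x) :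
    ∃ T' : ι → Finset V, (∀ i, T' i ∈ {A : Finset V | A.card = d ∧ (A ∩ P).Nonempty}) ∧
      ∑ i, indicatorVec (T i) = ∑ i, indicatorVec (T' i) := by
  obtain ⟨T', hT', hs, h1 | h1⟩ := exists_balanced T hT
  · exact ⟨T', fun i => ⟨(hT' i).1, h1 i⟩, hs.symm⟩
  refine ⟨T', fun i => ⟨(hT' i).1, ?_⟩, hs.symm⟩
  rw [← hs, sum_sum_indicatorVec] at h
  have h2 : ∑ i, (T' i ∩ P).card = ∑ _i : ι, 1 :=
    le_antisymm (Finset.sum_le_sum fun i _ => h1 i) (by simpa using h)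
  have h3 := (Finset.sum_eq_sum_iff_of_le fun i _ => h1 i).1 h2 i (Finset.mem_univ i)
  exact Finset.card_pos.1 (by omega)

theorem exists_meet_le_one_of_lt_card {P C : Finset V} {d : ℕ} (T : ι → Finset V)
    (hT : ∀ i, T i ∈ meetOrSubset P C d)
    (h : ∑ x ∈ P, (∑ i, indicatorVec (T i)) x < Fintype.card ι) :
    ∃ T' : ι → Finset V, (∀ i, T' i ∈ meetOrSubset P C d) ∧
      ∑ i, indicatorVec (T i) = ∑ i, indicatorVec (T' i) ∧ ∀ i, (T' i ∩ P).card ≤ 1 := by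
  obtain ⟨T', hT', hs, h1 | h1⟩ := exists_balanced T hT
  · rw [← hs, sum_sum_indicatorVec] at h
    refine absurd h (not_lt.2 ?_)
    calc Fintype.card ι = ∑ _i : ι, 1 := by simp
      _ ≤ _ := Finset.sum_le_sum fun i _ => Finset.card_pos.2 (h1 i)
  · exact ⟨T', hT', hs.symm, h1⟩

end PartiallySplit

/-! ### Linear quotients for the generators of the power. -/

section LinearQuotients

variable {V : Type*}

/-- The key by which generators of the power are ordered: first by the degree in `P`, cut off
at `q`, then lexicographically. -/
def quotientKey (P : Finset V) (q : ℕ) (u : V →₀ ℕ) : ℕ ×ₗ Lex (V → ℕ) :=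
  toLex (min (∑ x ∈ P, u x) q, toLex (u : V → ℕ))

theorem quotientKey_injective (P : Finset V) (q : ℕ) : (quotientKey P q).Injective := by
  intro u v h
  exact DFunLike.coe_injective (congrArg Prod.snd h)

theorem quotientKey_lt_iff [LinearOrder V] [Finite V] {P : Finset V} {q : ℕ} {u v : V →₀ ℕ} :
    quotientKey P q u < quotientKey P q v ↔
      min (∑ x ∈ P, u x) q < min (∑ x ∈ P, v x) q ∨
        min (∑ x ∈ P, u x) q = min (∑ x ∈ P, v x) q ∧ toLex (u : V → ℕ) < toLex (v : V → ℕ) :=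
  Prod.Lex.toLex_lt_toLex

theorem le_add_single_of_exchange {u w : V →₀ ℕ} {x z : V}
    (h : w + Finsupp.single z 1 = u + Finsupp.single x 1) : w ≤ u + Finsupp.single x 1 :=
  h ▸ le_self_add

theorem exists_linear_quotient [LinearOrder V] [Finite V] {ι : Type*} [Fintype ι]
    {P C : Finset V} {d : ℕ} (hd : d ≠ 0)
    {T W : ι → Finset V} (hT : ∀ i, T i ∈ meetOrSubset P C d)
    (hW : ∀ i, W i ∈ meetOrSubset P C d) {u v : V →₀ ℕ} (hu : u = ∑ i, indicatorVec (T i))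
    (hv : v = ∑ i, indicatorVec (W i))
    (huv : quotientKey P (Fintype.card ι) u < quotientKey P (Fintype.card ι) v) :
    ∃ (w : V →₀ ℕ) (T' : ι → Finset V), (∀ i, T' i ∈ meetOrSubset P C d) ∧
      w = ∑ i, indicatorVec (T' i) ∧
      quotientKey P (Fintype.card ι) u < quotientKey P (Fintype.card ι) w ∧
      ∃ x, w ≤ u + Finsupp.single x 1 ∧ u x < v x := by
  classical
  rw [quotientKey_lt_iff] at huv
  rcases le_or_gt (Fintype.card ι) (∑ x ∈ P, u x) with hq | hq
  -- All factors can be made to meet `P`. The exchange may lower the degree in `P`, but not below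
  -- `q`, so the cut-off leaves the first key unchanged.
  · rw [min_eq_right hq] at huv
    rcases huv with huv | ⟨hmin, huv⟩
    · exact absurd huv (not_lt.2 (min_le_right _ _))
    have hqv : Fintype.card ι ≤ ∑ x ∈ P, v x := min_eq_right_iff.1 hmin.symm
    obtain ⟨B, hB, hBs⟩ := exists_all_meet_of_card_le T hT (hu ▸ hq)
    obtain ⟨D, hD, hDs⟩ := exists_all_meet_of_card_le W hW (hv ▸ hqv)
    obtain ⟨x, z, w, B', hB', hw, hwu, hx, -, hlex⟩ := HasExchange.exists_lex_exchange
      (fun _ => hasExchange_inter_nonempty d P) hB hD (hu.trans hBs) (hv.trans hDs) huv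
    refine ⟨w, B', fun i => ⟨(hB' i).1, Or.inl (hB' i).2⟩, hw, ?_, x,
      le_add_single_of_exchange hwu, hx⟩
    rw [quotientKey_lt_iff, min_eq_right hq]
    refine Or.inr ⟨(min_eq_right ?_).symm, hlex⟩
    rw [hw, sum_sum_indicatorVec]
    calc Fintype.card ι = ∑ _i : ι, 1 := by simp
      _ ≤ _ := Finset.sum_le_sum fun i _ => Finset.card_pos.2 (hB' i).2
  by_cases hex : ∃ x ∈ P, u x < v x
  · obtain ⟨x, hxP, hx⟩ := hex
    obtain ⟨i, hi⟩ : ∃ i, T i ∩ P = ∅ := by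
      by_contra! hno
      rw [hu, sum_sum_indicatorVec] at hq
      refine hq.not_ge ?_
      calc Fintype.card ι = ∑ _i : ι, 1 := by simp
        _ ≤ _ := Finset.sum_le_sum fun i _ => Finset.card_pos.2 (hno i)
    have hiP : ∀ y ∈ T i, y ∉ P := fun y hy hyP =>
      Finset.notMem_empty y (hi ▸ Finset.mem_inter.2 ⟨hy, hyP⟩)
    -- Any `t` will do: the factor misses `P`, so replacing `t` by `x ∈ P` gives another generator
    -- and raises the first key.
    obtain ⟨t, ht⟩ : (T i).Nonempty := Finset.card_pos.1 (by have := (hT i).1; omega)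
    have hxi : x ∉ T i := fun h => hiP x h hxP
    have hs := sum_indicatorVec_exchange T hxi ht
    rw [← hu] at hs
    refine ⟨_, _, fun j => ?_, rfl, ?_, x, le_add_single_of_exchange hs, hx⟩
    · by_cases hj : j = i
      · subst hj
        rw [Function.update_self]
        exact ⟨(card_exchange hxi ht).trans (hT j).1, Or.inl ⟨x, by simp [hxP]⟩⟩
      · rw [Function.update_of_ne hj]
        exact hT j
    · have := sum_exchange (P := P) hs
      rw [if_pos hxP, if_neg (hiP t ht)] at this
      rw [quotientKey_lt_iff]
      left
      omega
  -- Now `v ≤ u` on `P`, and the order of the keys forces equality there.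
  push Not at hex
  have hle : ∑ x ∈ P, v x ≤ ∑ x ∈ P, u x := Finset.sum_le_sum hex
  rcases huv with huv | ⟨hmin, huv⟩
  · omega
  have heq : ∑ x ∈ P, v x = ∑ x ∈ P, u x := by omega
  have hP : ∀ x ∈ P, v x = u x := (Finset.sum_eq_sum_iff_of_le hex).1 heq
  obtain ⟨B, hB, hBs, hB1⟩ := exists_meet_le_one_of_lt_card T hT (hu ▸ hq)
  obtain ⟨D, hD, hDs, hD1⟩ := exists_meet_le_one_of_lt_card W hW (hv ▸ heq.trans_lt hq)
  have hcount : ∀ E : ι → Finset V, (∀ i, (E i ∩ P).card ≤ 1) →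
      ∑ x ∈ P, (∑ i, indicatorVec (E i)) x = Fintype.card {i // (E i ∩ P).card = 1} := by
    intro E hE
    rw [sum_sum_indicatorVec, Fintype.card_subtype, Finset.card_filter]
    refine Finset.sum_congr rfl fun i _ => ?_
    have := hE i
    split_ifs <;> omega
  have hcard : Fintype.card {i // (B i ∩ P).card = 1} = Fintype.card {i // (D i ∩ P).card = 1} := by
    rw [← hcount B hB1, ← hcount D hD1, ← hBs, ← hDs, ← hu, ← hv, heq]
  -- Equally many factors on both sides meet `P`. Permuting those of `v` by `e` puts matching
  -- factors into the same exchange family.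
  let e := (Fintype.equivOfCardEq hcard).extendSubtype
  let F : ι → Set (Finset V) := fun i => if (B i ∩ P).card = 1
    then {A : Finset V | A.card = d ∧ (A ∩ P).card = 1} else {A : Finset V | A.card = d ∧ A ⊆ C}
  have hFex : ∀ i, HasExchange (F i) := by
    intro i
    dsimp only [F]
    split_ifs
    · exact hasExchange_card_inter d 1 P
    · exact hasExchange_subset d C
  have hsub : ∀ A ∈ meetOrSubset P C d, (A ∩ P).card ≤ 1 → (A ∩ P).card ≠ 1 → A ⊆ C := by
    intro A hA h1 h2
    refine hA.2.resolve_left fun h => ?_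
    have := Finset.card_pos.2 h
    omega
  have hBF : ∀ i, B i ∈ F i := by
    intro i
    dsimp only [F]
    split_ifs with h
    · exact ⟨(hB i).1, h⟩
    · exact ⟨(hB i).1, hsub _ (hB i) (hB1 i) h⟩
  have hDF : ∀ i, D (e i) ∈ F i := by
    intro i
    dsimp only [F]
    split_ifs with h
    · exact ⟨(hD _).1, (Fintype.equivOfCardEq hcard).extendSubtype_mem i h⟩
    · exact ⟨(hD _).1, hsub _ (hD _) (hD1 _)
        ((Fintype.equivOfCardEq hcard).extendSubtype_not_mem i h)⟩
  obtain ⟨x, z, w, B', hB', hw, hwu, hx, hz, hlex⟩ := HasExchange.exists_lex_exchange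
    hFex hBF hDF (hu.trans hBs)
    ((hv.trans hDs).trans (Equiv.sum_comp e fun i => indicatorVec (D i)).symm) huv
  refine ⟨w, B', fun i => ?_, hw, ?_, x, le_add_single_of_exchange hwu, hx⟩
  · have := hB' i
    dsimp only [F] at this
    split_ifs at this
    · exact ⟨this.1, Or.inl (Finset.card_pos.1 (by have := this.2; omega))⟩
    · exact ⟨this.1, Or.inr this.2⟩
  -- Since `u` and `v` agree on `P`, both `x` and `z` lie outside `P`, and the first key is
  -- unchanged.
  · have hs := sum_exchange (P := P) hwu
    rw [if_neg fun h => hz.ne (hP z h), if_neg fun h => hx.ne' (hP x h), add_zero, add_zero] at hs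
    rw [quotientKey_lt_iff, hs]
    exact Or.inr ⟨rfl, hlex⟩

end LinearQuotients

/-! ### Connected sets in a partially split graph, and powers of the ideal. -/

section ConnectedIdeal

/-- A vertex of `K'` is joined to all others. In a set avoiding `K'`, a vertex of `S` would be
isolated, which `2 ≤ d` excludes for a connected set. -/
theorem induce_connected_iff_mem_meetOrSubset {V : Type*} [DecidableEq V]
    {G : SimpleGraph V} {K S K' : Set V} {P C : Finset V} (hKS : K ∪ S = Set.univ)
    (hK : G.IsClique K) (hS : G.IsIndepSet S) (hK' : K' ⊆ K)
    (hadj : ∀ x ∈ K, ∀ y ∈ S, G.Adj x y ↔ x ∈ K') (hP : ∀ x, x ∈ P ↔ x ∈ K')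
    (hC : ∀ x, x ∈ C ↔ x ∈ K) {d : ℕ} (hd : 2 ≤ d) (T : Finset V) :
    T.card = d ∧ (G.induce (T : Set V)).Connected ↔ T ∈ meetOrSubset P C d := by
  have hcover : ∀ x, x ∈ K ∨ x ∈ S := fun x =>
    (Set.mem_union _ _ _).1 (hKS ▸ Set.mem_univ x)
  refine and_congr_right fun hcard => ⟨fun h => ?_, fun h => ?_⟩
  · rw [or_iff_not_imp_left, Finset.not_nonempty_iff_eq_empty, Finset.eq_empty_iff_forall_notMem]
    intro hTP x hx
    have hTK' : ∀ y ∈ T, y ∉ K' := fun y hy hyK =>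
      hTP y (Finset.mem_inter.2 ⟨hy, (hP y).2 hyK⟩)
    refine (hC x).2 ((hcover x).resolve_right fun hxS => ?_)
    have : Nontrivial (T : Set V) := by
      rw [Set.nontrivial_coe_sort]
      exact Finset.one_lt_card_iff_nontrivial.1 (by omega)
    obtain ⟨⟨y, hy⟩, hxy⟩ := h.preconnected.exists_adj_of_nontrivial ⟨x, hx⟩
    have hxy : G.Adj x y := hxy
    rcases hcover y with hyK | hyS
    · exact hTK' y hy ((hadj y hyK x hxS).1 hxy.symm)
    · exact hS hxS hyS hxy.ne hxy
  · rcases h with ⟨c, hc⟩ | h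
    · rw [Finset.mem_inter, hP] at hc
      have hc' : ∀ y, y ≠ c → G.Adj c y := by
        intro y hy
        rcases hcover y with hyK | hyS
        · exact hK (hK' hc.2) hyK hy.symm
        · exact (hadj c (hK' hc.2) y hyS).2 hc.2
      rw [SimpleGraph.connected_iff_exists_forall_reachable]
      refine ⟨⟨c, hc.1⟩, fun y => ?_⟩
      by_cases hy : y = ⟨c, hc.1⟩
      · rw [hy]
      · exact SimpleGraph.Adj.reachable (hc' y fun h => hy (Subtype.ext h))
    · have hne : T.Nonempty := Finset.card_pos.1 (by omega)
      obtain ⟨c, hc⟩ := hne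
      rw [SimpleGraph.connected_iff_exists_forall_reachable]
      refine ⟨⟨c, hc⟩, fun y => ?_⟩
      by_cases hy : y = ⟨c, hc⟩
      · rw [hy]
      · exact SimpleGraph.Adj.reachable (hK ((hC c).1 (h hc)) ((hC y).1 (h y.2))
          fun h => hy (Subtype.ext h.symm))

theorem MvPolynomial.span_prod_X_pow {k V : Type*} [Field k] (F : Set (Finset V)) (q : ℕ) :
    Ideal.span {f : MvPolynomial V k | ∃ T ∈ F, f = ∏ x ∈ T, X x} ^ q =
      Ideal.span ((fun u => monomial u (1 : k)) ''
        {u | ∃ T : Fin q → Finset V, (∀ i, T i ∈ F) ∧ u = ∑ i, indicatorVec (T i)}) := by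
  have hX : ∀ T : Finset V, (∏ x ∈ T, X x : MvPolynomial V k) = monomial (indicatorVec T) 1 :=
    fun T => (monomial_sum_one T _).symm
  rw [Ideal.span, Submodule.span_pow]
  congr 1
  ext f
  rw [Set.mem_pow]
  constructor
  · rintro ⟨g, rfl⟩
    choose T hT hg using fun i => (g i).2
    refine ⟨_, ⟨T, hT, rfl⟩, ?_⟩
    simp only [hg, hX, List.prod_ofFn]
    exact monomial_sum_one _ _
  · rintro ⟨_, ⟨T, hT, rfl⟩, rfl⟩
    refine ⟨fun i => ⟨_, T i, hT i, rfl⟩, ?_⟩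
    simp only [hX, List.prod_ofFn]
    exact (monomial_sum_one _ _).symm

theorem hasLinearResolution_span_meetOrSubset_pow {k V : Type*} [Field k] [Finite V]
    [LinearOrder V] {P C : Finset V} {d : ℕ} (hd : d ≠ 0) (q : ℕ) :
    HasLinearResolution (Ideal.span {f : MvPolynomial V k | ∃ T ∈ meetOrSubset P C d,
      f = ∏ x ∈ T, MvPolynomial.X x} ^ q) := by
  rw [MvPolynomial.span_prod_X_pow]
  set A := {u | ∃ T : Fin q → Finset V, (∀ i, T i ∈ meetOrSubset P C d) ∧
    u = ∑ i, indicatorVec (T i)} with hA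
  have hfin : A.Finite := by
    refine (Set.finite_range fun T : Fin q → Finset V => ∑ i, indicatorVec (T i)).subset ?_
    rintro _ ⟨T, -, rfl⟩
    exact ⟨T, rfl⟩
  rw [← hfin.coe_toFinset]
  refine hasLinearResolution_of_linearQuotients _ (quotientKey P q) (quotientKey_injective P q)
    (q * d) ?_ ?_
  · intro u hu
    obtain ⟨T, hT, rfl⟩ := hfin.mem_toFinset.1 hu
    simp [map_sum, degree_indicatorVec, fun i => (hT i).1]
  · intro u hu v hv huv
    obtain ⟨T, hT, hTu⟩ := hfin.mem_toFinset.1 hu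
    obtain ⟨W, hW, hWv⟩ := hfin.mem_toFinset.1 hv
    obtain ⟨w, T', hT', hw, hlt, h⟩ :=
      exists_linear_quotient hd hT hW hTu hWv (by rwa [Fintype.card_fin])
    rw [Fintype.card_fin] at hlt
    exact ⟨w, hfin.mem_toFinset.2 ⟨T', hT', hw⟩, hlt, h⟩

end ConnectedIdeal

theorem mainTheorem6 {k : Type*} [Field k] {V : Type*} [Fintype V] (G : SimpleGraph V)
    (hG : IsPartiallySplit G) (r q : ℕ) (hr : 2 ≤ r) (hq : 1 ≤ q) :
    HasLinearResolution (connectedIdeal k G r ^ q) := by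
  obtain ⟨K, S, K', hKS, -, hK, hS, -, hK', hadj⟩ := hG
  -- Any order of the variables serves for the lexicographic comparison.
  let _ : LinearOrder V := LinearOrder.lift' (Fintype.equivFin V) (Fintype.equivFin V).injective
  have h : connectedIdeal k G r = Ideal.span {f | ∃ T ∈ meetOrSubset (Set.toFinite K').toFinset
      (Set.toFinite K).toFinset (r + 1), f = ∏ x ∈ T, MvPolynomial.X x} := by
    simp only [← induce_connected_iff_mem_meetOrSubset hKS hK hS hK' hadj
      (fun x => Set.Finite.mem_toFinset _) (fun x => Set.Finite.mem_toFinset _)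
      (show 2 ≤ r + 1 by omega), and_assoc, connectedIdeal]
  rw [h]
  exact hasLinearResolution_span_meetOrSubset_pow (Nat.succ_ne_zero r) q
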